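/- Setting. A depth-$d$ 1D-QAC circuit on a line of $m$ qubits is a unitary $C=L_dM_d\cdots L_1M_1L_0$, where each $L_k$ is a tensor product of arbitrary single-qubit unitaries and each $M_k$ is a product of $\mathrm{CZ}$ gates whose supports are pairwise disjoint nonempty intervals of consecutive qubits; the $\mathrm{CZ}$ gate with support $T$ multiplies a computational basis state by $-1$ if all qubits of $T$ are $1$ and fixes it otherwise. A set $I$ of $n$ of the $m$ qubits, at arbitrary positions, carries the input; the set $A$ of the other qubits (arbitrarily many) consists of ancillas initialised to $|0\rangle_A$. For $x\in\{0,1\}^I$ let $|\rho_C^x\rangle = C\,(|x\rangle_I|0\rangle_A)$ and $\rho_C^x=|\rho_C^x\rangle\langle\rho_C^x|$, and let $\bar x$ be the bitwise complement of $x$. An input-dependent nekomata state is $|\sigma^x\rangle=\frac1{\sqrt2}\big(|x\rangle_I|\psi_{x,0}\rangle_A+|\bar x\rangle_I|\psi_{x,1}\rangle_A\big)$ with $|\psi_{x,0}\rangle,|\psi_{x,1}\rangle$ arbitrary unit vectors on $A$; write $\sigma^x=|\sigma^x\rangle\langle\sigma^x|$. Let $\|M\|_1=\mathrm{Tr}\sqrt{M^\dagger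 M}$ be the (unnormalised) trace norm, and let $\mathbb E_x$ be the average over uniform $x\in\{0,1\}^I$. Theorem. There is an absolute constant $c>0$ such that the following holds for all integers $n,d\ge1$ and all $0<\varepsilon<1$. Put $t=\log_2(n/\varepsilon)$. For every depth-$d$ 1D-QAC circuit $C$ with a set $I$ of $n$ input qubits and ancilla qubits $A$, and for every family $(\sigma^x)_{x\in\{0,1\}^I}$ of input-dependent nekomata states, $$\mathbb E_x\big\|\mathrm{Tr}_A[\rho_C^x]-\mathrm{Tr}_A[\sigma^x]\big\|_1\;\ge\;\frac18-2^{-c\,(n/t^d-1)}-16\,d\,\varepsilon .$$ In particular, for the in-place input-dependent cat states $|\mathrm{Cat}_x\rangle=\frac1{\sqrt2}(|x\rangle+|\bar x\rangle)$ on the input qubits, $$\mathbb E_x\big\|\mathrm{Tr}_A[\rho_C^x]-|\mathrm{Cat}_x\rangle\langle \mathrm{Cat}_x|\big\|_1\;\ge\;\frac18-2^{-c\,(n/t^d-1)}-16\,d\,\varepsilon .$$ -/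

import Mathlib

namespace QACLine

/-- Classical bit strings on a register whose qubits are labelled by `V`. -/
abbrev Bits (V : Type*) := V → Bool

/-- A (not necessarily normalised) vector of the Hilbert space of the register `V`, written in the
computational basis. -/
abbrev Ket (V : Type*) := Bits V → ℂ

/-- An operator on the Hilbert space of the register `V`, written in the computational basis. -/
abbrev Op (V : Type*) := Matrix (Bits V) (Bits V) ℂ

/-- The ket is a pure state: `∑ |ψ z|² = 1`. -/
def IsUnitKet {V : Type*} [Fintype V] [DecidableEq V] (ψ : Ket V) : Prop :=
  ∑ z, ‖ψ z‖ ^ 2 = 1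

/-- The computational basis vector `|x⟩`. -/
def basisKet {V : Type*} [Fintype V] [DecidableEq V] (x : Bits V) : Ket V :=
  fun z => if z = x then 1 else 0

/-- The operator `|ψ⟩⟨ψ|`. -/
def proj {V : Type*} (ψ : Ket V) : Op V :=
  Matrix.vecMulVec ψ (star ψ)

/-- The bitwise complement `x̄`. -/
def compl {V : Type*} (x : Bits V) : Bits V := fun i => !(x i)

/-- The (unnormalised) trace norm `‖M‖₁ = Tr √(M† M)`: the sum of the singular values of `M`. -/
noncomputable def traceNorm {κ : Type*} [Fintype κ] [DecidableEq κ] (M : Matrix κ κ ℂ) : ℝ :=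
  ∑ k, Real.sqrt ((Matrix.isHermitian_conjTranspose_mul_self M).eigenvalues k)

/-! ### Circuits on a line of `m` qubits -/

/-- A layer of arbitrary single-qubit unitaries, one for each of the `m` qubits. -/
abbrev SingleLayer (m : ℕ) := Fin m → Matrix.unitaryGroup Bool ℂ

/-- The tensor product of the single-qubit unitaries of a layer. -/
def SingleLayer.op {m : ℕ} (L : SingleLayer m) : Op (Fin m) :=
  fun z w => ∏ i, (L i : Matrix Bool Bool ℂ) (z i) (w i)

/-- The diagonal entry at `z` of the `CZ` gate with support `T`: it is `-1` if all the qubits of `T`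
are `1`, and `1` otherwise. -/
def czPhase {m : ℕ} (T : Finset (Fin m)) (z : Bits (Fin m)) : ℂ :=
  if ∀ i ∈ T, z i = true then -1 else 1

/-- The `CZ` gate with support `T` (tensored with the identity on the other qubits). -/
def czGate {m : ℕ} (T : Finset (Fin m)) : Op (Fin m) :=
  Matrix.diagonal (czPhase T)

/-- A layer of `CZ` gates of arbitrary sizes, given by the set of their supports: pairwise disjoint
nonempty intervals of consecutive qubits of the line. -/
structure CZLayer (m : ℕ) where
  supports : Finset (Finset (Fin m))
  interval : ∀ T ∈ supports, ∃ a b : Fin m, a ≤ b ∧ T = Finset.Icc a b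
  disjoint : ∀ T ∈ supports, ∀ T' ∈ supports, T ≠ T' → Disjoint T T'

/-- The product of the (commuting, diagonal) `CZ` gates of a layer. -/
def CZLayer.op {m : ℕ} (M : CZLayer m) : Op (Fin m) :=
  Matrix.diagonal fun z => ∏ T ∈ M.supports, czPhase T z

/-- The operator of a layer is built by multiplying its gates together. -/
theorem diagonal_prod_insert {m : ℕ} (T : Finset (Fin m)) (s : Finset (Finset (Fin m)))
    (hT : T ∉ s) :
    Matrix.diagonal (fun z => ∏ T' ∈ insert T s, czPhase T' z) =
      czGate T * Matrix.diagonal (fun z => ∏ T' ∈ s, czPhase T' z) := by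
  simp [czGate, Finset.prod_insert hT]

/-- One-dimensional `QAC` circuits `L_d M_d ⋯ L_1 M_1 L_0` on `m` qubits, where the `L_k` are layers
of single-qubit unitaries and the `M_k` are layers of `CZ` gates. The depth `d` is the number of
`CZ` layers. -/
inductive Circuit (m : ℕ) : ℕ → Type
  | base (L : SingleLayer m) : Circuit m 0
  | step {d : ℕ} (C : Circuit m d) (M : CZLayer m) (L : SingleLayer m) : Circuit m (d + 1)

/-- The unitary operator that a circuit performs. -/
def Circuit.op {m : ℕ} : {d : ℕ} → Circuit m d → Op (Fin m)
  | _, .base L => L.op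
  | _, .step C M L => L.op * M.op * C.op

/-! ### Input and ancilla qubits

The input qubits form an arbitrary set `I` of positions on the line; all the other qubits are
ancillas. -/

/-- The ancilla qubits `A`. -/
abbrev Anc {m : ℕ} (I : Finset (Fin m)) := {i : Fin m // i ∉ I}

/-- The string on all qubits which is `x` on the input qubits and `a` on the ancillas. -/
def join {m : ℕ} (I : Finset (Fin m)) (x : Bits I) (a : Bits (Anc I)) : Bits (Fin m) :=
  fun i => if h : i ∈ I then x ⟨i, h⟩ else a ⟨i, h⟩

/-- The product vector `|φ⟩_I |ψ⟩_A`. -/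
def tensor {m : ℕ} (I : Finset (Fin m)) (φ : Ket I) (ψ : Ket (Anc I)) : Ket (Fin m) :=
  fun z => φ (fun i => z i) * ψ (fun i => z i)

/-- The partial trace `Tr_A` over the ancilla qubits. -/
def traceAnc {m : ℕ} (I : Finset (Fin m)) (M : Op (Fin m)) : Op I :=
  fun x y => ∑ a : Bits (Anc I), M (join I x a) (join I y a)

/-- The output state `C (|x⟩_I |0⟩_A)` of the circuit. -/
def Circuit.output {m d : ℕ} (C : Circuit m d) (I : Finset (Fin m)) (x : Bits I) : Ket (Fin m) :=
  C.op.mulVec (tensor I (basisKet x) (basisKet fun _ => false))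

/-- The input-dependent cat state `(|x⟩ + |x̄⟩) / √2` on the input qubits. -/
noncomputable def catKet {m : ℕ} (I : Finset (Fin m)) (x : Bits I) : Ket I :=
  ((Real.sqrt 2 : ℝ) : ℂ)⁻¹ • (basisKet x + basisKet (compl x))

/-- The input-dependent nekomata state `(|x⟩_I |ψ₀⟩_A + |x̄⟩_I |ψ₁⟩_A) / √2`. -/
noncomputable def nekomataKet {m : ℕ} (I : Finset (Fin m)) (x : Bits I)
    (ψ₀ ψ₁ : Ket (Anc I)) : Ket (Fin m) :=
  ((Real.sqrt 2 : ℝ) : ℂ)⁻¹ • (tensor I (basisKet x) ψ₀ + tensor I (basisKet (compl x)) ψ₁)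

/-- The average of `f` over uniformly random inputs `x ∈ {0,1}^I`. -/
noncomputable def expect {m : ℕ} (I : Finset (Fin m)) (f : Bits I → ℝ) : ℝ :=
  (∑ x, f x) / 2 ^ I.card

end QACLine

namespace QACLine

/-! In a nekomata state any two input positions `i`, `j` satisfy ⟨Z_i⟩ = ⟨Z_j⟩ = 0 but ⟨Z_i Z_j⟩ =
±1. If the backward light cones of `i` and `j` are disjoint, a computational basis input forces ⟨Z_i
Z_j⟩ = ⟨Z_i⟩⟨Z_j⟩ (`Circuit.sum_sign_mul_sign`), so the output is at constant trace distance from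
every such state (`three_fifths_le_traceNorm_add`).

Long CZ gates can make light cones as large as the line. `Circuit.prune` therefore removes, layer by
layer, each gate whose support `T` contains the whole forward light cones of at least `τ` inputs.
Such a gate acts only when all of `T` is `1`. Those `τ` random bits influence nothing outside `T`,
so unitarity makes this event have average probability at most 2^(-τ)
(`Circuit.sum_sum_norm_sq_le`). All removals together move the state by at most 2d√(n/2^τ) on
average (`Circuit.expect_norm_output_sub_prune_le`).

After pruning, one-dimensionality takes over: across any cut of the line at most (2^d - 1)τ inputs
have forward cones on both sides (`Circuit.card_crossing_prune_add_le`), hence a backward cone of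
one qubit contains at most 2^(d+1)τ inputs. Backward cones of single qubits are intervals, so once n
> 2^(d+2)τ the leftmost and rightmost inputs have disjoint cones (`Circuit.exists_disjoint_back`).
The choice τ = ⌈2t⌉ balances the two estimates. -/

/-! ### Operators supported on a set of qubits -/

/-- Flip the bits of `z` at the positions marked by `s`. -/
def flipBits {V : Type*} (s : Bits V) : Equiv.Perm (Bits V) :=
  Function.Involutive.toPerm (fun z i => xor (z i) (s i)) fun z => by
    funext i; simp

@[simp]
theorem flipBits_apply {V : Type*} (s z : Bits V) (i : V) : flipBits s z i = xor (z i) (s i) :=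
  rfl

/-- The operator `A` acts only on the qubits of `S`: it is of the form `A' ⊗ 1`. -/
structure SupportedOn {V : Type*} (S : Finset V) (A : Op V) : Prop where
  eq_of_ne_zero : ∀ z w, A z w ≠ 0 → ∀ i ∉ S, z i = w i
  flip : ∀ s : Bits V, (∀ i ∈ S, s i = false) → ∀ z w, A (flipBits s z) (flipBits s w) = A z w

section

variable {V : Type*} {S S' : Finset V} {A B : Op V}

theorem SupportedOn.mono (hA : SupportedOn S A) (h : S ⊆ S') : SupportedOn S' A :=
  ⟨fun z w hzw i hi => hA.eq_of_ne_zero z w hzw i fun h' => hi (h h'),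
    fun s hs => hA.flip s fun i hi => hs i (h hi)⟩

theorem SupportedOn.mul [Fintype V] [DecidableEq V] (hA : SupportedOn S A)
    (hB : SupportedOn S B) : SupportedOn S (A * B) := by
  refine ⟨fun z w h i hi => ?_, fun s hs z w => ?_⟩
  · rw [Matrix.mul_apply] at h
    obtain ⟨v, -, hv⟩ := Finset.exists_ne_zero_of_sum_ne_zero h
    rw [hA.eq_of_ne_zero z v (left_ne_zero_of_mul hv) i hi,
      hB.eq_of_ne_zero v w (right_ne_zero_of_mul hv) i hi]
  · rw [Matrix.mul_apply, Matrix.mul_apply, ← Equiv.sum_comp (flipBits s)]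
    exact Finset.sum_congr rfl fun v _ => by rw [hA.flip s hs, hB.flip s hs]

/-- Operators acting on disjoint sets of qubits commute. -/
theorem SupportedOn.mul_comm [Fintype V] [DecidableEq V] (hA : SupportedOn S A)
    (hB : SupportedOn S' B) (h : Disjoint S S') : A * B = B * A := by
  ext z w
  -- Each matrix product has only one possible intermediate string, `v` for `A * B` and `v'` for `B
  -- * A`; flip invariance then matches the factors.
  set v : Bits V := fun i => if i ∈ S then w i else z i with hv
  set v' : Bits V := fun i => if i ∈ S then z i else w i with hv'
  have hS : ∀ i ∈ S, i ∉ S' := fun i hi hi' => Finset.disjoint_left.1 h hi hi'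
  rw [Matrix.mul_apply, Matrix.mul_apply, Finset.sum_eq_single v, Finset.sum_eq_single v']
  · by_cases hzw : ∀ i, i ∉ S → i ∉ S' → z i = w i
    · have e1 : A z v = A v' w := by
        rw [← hA.flip (fun i => if i ∈ S then false else xor (z i) (w i)) (by simp +contextual)]
        congr 1 <;> funext i <;> by_cases hi : i ∈ S <;> simp [hv, hv', hi]
      have e2 : B v w = B z v' := by
        rw [← hB.flip (fun i => if i ∈ S then xor (z i) (w i) else false) (by
          intro i hi; rw [if_neg fun h' => hS i h' hi])]
        congr 1 <;> funext i <;> by_cases hi : i ∈ S <;> simp [hv, hv', hi, Bool.xor_left_comm]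
      rw [e1, e2, _root_.mul_comm]
    · push Not at hzw
      obtain ⟨i, hi, hi', hne⟩ := hzw
      rw [show B v w = 0 from by_contra fun h0 => hne (by
          simpa [hv, hi] using hB.eq_of_ne_zero _ _ h0 i hi'),
        show B z v' = 0 from by_contra fun h0 => hne (by
          simpa [hv', hi] using hB.eq_of_ne_zero _ _ h0 i hi')]
      simp
  · intro u _ hu
    by_contra h0
    refine hu (funext fun i => ?_)
    by_cases hi : i ∈ S
    · simpa [hv', hi] using (hB.eq_of_ne_zero _ _ (left_ne_zero_of_mul h0) i (hS i hi)).symm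
    · simpa [hv', hi] using hA.eq_of_ne_zero _ _ (right_ne_zero_of_mul h0) i hi
  · simp
  · intro u _ hu
    by_contra h0
    refine hu (funext fun i => ?_)
    by_cases hi : i ∈ S
    · simpa [hv, hi] using hB.eq_of_ne_zero _ _ (right_ne_zero_of_mul h0) i (hS i hi)
    · simpa [hv, hi] using (hA.eq_of_ne_zero _ _ (left_ne_zero_of_mul h0) i hi).symm
  · simp

end

/-! ### Layers -/

theorem SingleLayer.op_mul {m : ℕ} (L L' : SingleLayer m) :
    SingleLayer.op (L * L') = L.op * L'.op := by
  ext z w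
  simp only [SingleLayer.op, Matrix.mul_apply, Pi.mul_apply, Submonoid.coe_mul,
    Finset.prod_univ_sum, ← Finset.prod_mul_distrib, Fintype.piFinset_univ]

theorem SingleLayer.op_one {m : ℕ} : SingleLayer.op (1 : SingleLayer m) = 1 := by
  ext z w
  simp only [SingleLayer.op, Pi.one_apply, OneMemClass.coe_one, Matrix.one_apply,
    Finset.prod_ite_zero, Finset.prod_const_one, Finset.mem_univ, true_imp_iff, funext_iff]

theorem SingleLayer.op_star {m : ℕ} (L : SingleLayer m) :
    star L.op = SingleLayer.op (star L) := by
  ext z w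
  simp [SingleLayer.op, Matrix.star_apply]

theorem SingleLayer.op_mem_unitaryGroup {m : ℕ} (L : SingleLayer m) :
    L.op ∈ Matrix.unitaryGroup (Bits (Fin m)) ℂ := by
  rw [Matrix.mem_unitaryGroup_iff', SingleLayer.op_star, ← SingleLayer.op_mul,
    ← SingleLayer.op_one]
  congr 1
  funext i
  exact Subtype.ext (Matrix.UnitaryGroup.star_mul_self (L i))

/-- The unitaries of a layer that act on the qubits of `S`. -/
def SingleLayer.restrict {m : ℕ} (L : SingleLayer m) (S : Finset (Fin m)) : SingleLayer m :=
  fun i => if i ∈ S then L i else 1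

theorem SingleLayer.restrict_mul_restrict_compl {m : ℕ} (L : SingleLayer m)
    (S : Finset (Fin m)) : L.restrict Sᶜ * L.restrict S = L := by
  funext i
  by_cases h : i ∈ S <;> simp [SingleLayer.restrict, h]

theorem SingleLayer.supportedOn_restrict {m : ℕ} (L : SingleLayer m) (S : Finset (Fin m)) :
    SupportedOn S (L.restrict S).op := by
  refine ⟨fun z w h i hi => ?_, fun s hs z w => Finset.prod_congr rfl fun i _ => ?_⟩
  · have := Finset.prod_ne_zero_iff.1 h i (Finset.mem_univ i)
    by_contra hne
    simp [SingleLayer.restrict, hi, hne] at this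
  · by_cases hi : i ∈ S
    · simp [hs i hi]
    · simp [SingleLayer.restrict, hi, Matrix.one_apply]

/-- The gates of a layer of `CZ` gates whose supports satisfy `p`. -/
def CZLayer.filter {m : ℕ} (M : CZLayer m) (p : Finset (Fin m) → Prop) [DecidablePred p] :
    CZLayer m where
  supports := M.supports.filter p
  interval T hT := M.interval T (Finset.mem_of_mem_filter T hT)
  disjoint T hT T' hT' := M.disjoint T (Finset.mem_of_mem_filter T hT) T'
    (Finset.mem_of_mem_filter T' hT')

theorem CZLayer.filter_op_mul_filter_not_op {m : ℕ} (M : CZLayer m) (p : Finset (Fin m) → Prop)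
    [DecidablePred p] : (M.filter p).op * (M.filter fun T => ¬p T).op = M.op := by
  simp only [CZLayer.op, CZLayer.filter, Matrix.diagonal_mul_diagonal,
    Finset.prod_filter_mul_prod_filter_not]

theorem norm_czPhase {m : ℕ} (T : Finset (Fin m)) (z : Bits (Fin m)) : ‖czPhase T z‖ = 1 := by
  unfold czPhase; split_ifs <;> simp

theorem CZLayer.op_mem_unitaryGroup {m : ℕ} (M : CZLayer m) :
    M.op ∈ Matrix.unitaryGroup (Bits (Fin m)) ℂ := by
  rw [Matrix.mem_unitaryGroup_iff', Matrix.star_eq_conjTranspose, CZLayer.op,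
    Matrix.diagonal_conjTranspose, Matrix.diagonal_mul_diagonal, ← Matrix.diagonal_one]
  congr 1
  funext z
  rw [Pi.star_apply, RCLike.star_def, Complex.conj_mul', norm_prod]
  simp [norm_czPhase]

theorem CZLayer.supportedOn_op {m : ℕ} (M : CZLayer m) (S : Finset (Fin m))
    (h : ∀ T ∈ M.supports, T ⊆ S) : SupportedOn S M.op := by
  refine ⟨fun z w hzw i _ => ?_, fun s hs z w => ?_⟩
  · by_contra hne
    exact hzw (Matrix.diagonal_apply_ne _ fun h => hne (congrFun h i))
  · by_cases hzw : z = w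
    · subst hzw
      simp only [CZLayer.op, Matrix.diagonal_apply_eq]
      refine Finset.prod_congr rfl fun T hT => ?_
      unfold czPhase
      congr 1
      exact propext (forall₂_congr fun i hi => by simp [hs i (h T hT hi)])
    · rw [CZLayer.op, Matrix.diagonal_apply_ne _ hzw,
        Matrix.diagonal_apply_ne _ fun h => hzw ((flipBits s).injective h)]

/-! ### Backward light cones -/

/-- The set `S` enlarged by the supports of the gates that meet it. -/
def CZLayer.spread {m : ℕ} (M : CZLayer m) (S : Finset (Fin m)) : Finset (Fin m) :=
  S ∪ (M.supports.filter fun T => ¬Disjoint T S).biUnion id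

theorem CZLayer.mem_spread {m : ℕ} {M : CZLayer m} {S : Finset (Fin m)} {i : Fin m} :
    i ∈ M.spread S ↔ i ∈ S ∨ ∃ T ∈ M.supports, ¬Disjoint T S ∧ i ∈ T := by
  simp [CZLayer.spread, and_assoc]

theorem CZLayer.subset_spread {m : ℕ} (M : CZLayer m) (S : Finset (Fin m)) : S ⊆ M.spread S :=
  Finset.subset_union_left

/-- The backward light cone of a set `S` of output qubits. -/
def Circuit.back {m : ℕ} : {d : ℕ} → Circuit m d → Finset (Fin m) → Finset (Fin m)
  | _, .base _, S => S
  | _, .step C M _, S => C.back (M.spread S)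

theorem Circuit.subset_back {m d : ℕ} (C : Circuit m d) (S : Finset (Fin m)) : S ⊆ C.back S := by
  induction C generalizing S with
  | base L => exact subset_rfl
  | step C M L ih => exact (M.subset_spread S).trans (ih _)

theorem Circuit.op_mem_unitaryGroup {m d : ℕ} (C : Circuit m d) :
    C.op ∈ Matrix.unitaryGroup (Bits (Fin m)) ℂ := by
  induction C with
  | base L => exact L.op_mem_unitaryGroup
  | step C M L ih => exact mul_mem (mul_mem L.op_mem_unitaryGroup M.op_mem_unitaryGroup) ih

/-- A circuit is a unitary on the backward light cone of `S` followed by a unitary on the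
complement of `S`. -/
theorem Circuit.exists_eq_mul {m d : ℕ} (C : Circuit m d) (S : Finset (Fin m)) :
    ∃ W V : Op (Fin m), W ∈ Matrix.unitaryGroup (Bits (Fin m)) ℂ ∧
      V ∈ Matrix.unitaryGroup (Bits (Fin m)) ℂ ∧ SupportedOn Sᶜ W ∧
      SupportedOn (C.back S) V ∧ C.op = W * V := by
  induction C generalizing S with
  | base L =>
    refine ⟨(L.restrict Sᶜ).op, (L.restrict S).op, SingleLayer.op_mem_unitaryGroup _,
      SingleLayer.op_mem_unitaryGroup _, L.supportedOn_restrict _, L.supportedOn_restrict _, ?_⟩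
    rw [← SingleLayer.op_mul, SingleLayer.restrict_mul_restrict_compl, Circuit.op]
  | step C M L ih =>
    obtain ⟨W, V, hW, hV, sW, sV, hC⟩ := ih (M.spread S)
    have hS := M.subset_spread S
    have hSc : (M.spread S)ᶜ ⊆ Sᶜ := Finset.compl_subset_compl.2 hS
    -- Gates missing `S` and single-qubit unitaries off `S` join `W`. The remaining ones live on
    -- `M.spread S`, which `W` avoids, so they commute past `W` and join `V`.
    set Min := M.filter fun T => Disjoint T S
    set Mout := M.filter fun T => ¬Disjoint T S
    have sMin : SupportedOn Sᶜ Min.op := Min.supportedOn_op _ fun T hT =>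
      Finset.subset_compl_iff_disjoint_right.2 (Finset.mem_filter.1 hT).2
    have sMout : SupportedOn (M.spread S) Mout.op := Mout.supportedOn_op _ fun T hT i hi =>
      CZLayer.mem_spread.2 (Or.inr ⟨T, (Finset.mem_filter.1 hT).1, (Finset.mem_filter.1 hT).2, hi⟩)
    have sL := L.supportedOn_restrict S
    have sL' := L.supportedOn_restrict Sᶜ
    refine ⟨(L.restrict Sᶜ).op * Min.op * W, (L.restrict S).op * Mout.op * V,
      mul_mem (mul_mem (SingleLayer.op_mem_unitaryGroup _) (CZLayer.op_mem_unitaryGroup _)) hW,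
      mul_mem (mul_mem (SingleLayer.op_mem_unitaryGroup _) (CZLayer.op_mem_unitaryGroup _)) hV,
      (sL'.mul sMin).mul (sW.mono hSc), (((sL.mono hS).mul sMout).mono (C.subset_back _)).mul sV,
      ?_⟩
    have hM : M.op = Min.op * Mout.op := (M.filter_op_mul_filter_not_op _).symm
    have hL : L.op = (L.restrict Sᶜ).op * (L.restrict S).op := by
      rw [← SingleLayer.op_mul, SingleLayer.restrict_mul_restrict_compl]
    have c1 : (L.restrict S).op * Min.op = Min.op * (L.restrict S).op :=
      sL.mul_comm sMin disjoint_compl_right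
    have c2 : (L.restrict S).op * Mout.op * W = W * ((L.restrict S).op * Mout.op) :=
      ((sL.mono hS).mul sMout).mul_comm sW disjoint_compl_right
    calc (Circuit.step C M L).op
        = (L.restrict Sᶜ).op * ((L.restrict S).op * Min.op) * Mout.op * W * V := by
          rw [Circuit.op, hL, hM, hC]; simp only [mul_assoc]
      _ = (L.restrict Sᶜ).op * Min.op * ((L.restrict S).op * Mout.op * W) * V := by
          rw [c1]; simp only [mul_assoc]
      _ = _ := by rw [c2]; simp only [mul_assoc]

/-! ### Probabilities -/

theorem sum_norm_sq_mulVec {κ : Type*} [Fintype κ] [DecidableEq κ] {U : Matrix κ κ ℂ}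
    (hU : U ∈ Matrix.unitaryGroup κ ℂ) (ψ : κ → ℂ) :
    ∑ z, ‖U.mulVec ψ z‖ ^ 2 = ∑ z, ‖ψ z‖ ^ 2 := by
  have key : ∀ φ : κ → ℂ, ((∑ z, ‖φ z‖ ^ 2 : ℝ) : ℂ) = star φ ⬝ᵥ φ := fun φ => by
    simp [dotProduct, Complex.conj_mul']
  have : star (U.mulVec ψ) ⬝ᵥ U.mulVec ψ = star ψ ⬝ᵥ ψ := by
    rw [Matrix.star_mulVec, Matrix.dotProduct_mulVec, Matrix.vecMul_vecMul,
      ← Matrix.star_eq_conjTranspose, Matrix.mem_unitaryGroup_iff'.1 hU, Matrix.vecMul_one]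
  exact_mod_cast (key _).trans (this.trans (key _).symm)

theorem sum_norm_sq_col {κ : Type*} [Fintype κ] [DecidableEq κ] {U : Matrix κ κ ℂ}
    (hU : U ∈ Matrix.unitaryGroup κ ℂ) (w : κ) : ∑ z, ‖U z w‖ ^ 2 = 1 := by
  have := sum_norm_sq_mulVec hU (Pi.single w 1)
  simpa [Pi.single_apply, apply_ite (fun c : ℂ => ‖c‖ ^ 2)] using this

theorem sum_norm_sq_row {κ : Type*} [Fintype κ] [DecidableEq κ] {U : Matrix κ κ ℂ}
    (hU : U ∈ Matrix.unitaryGroup κ ℂ) (z : κ) : ∑ w, ‖U z w‖ ^ 2 = 1 := by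
  simpa [Matrix.star_apply] using sum_norm_sq_col (Unitary.star_mem hU) z

theorem norm_mulVec_of_mem_unitaryGroup {κ : Type*} [Fintype κ] [DecidableEq κ]
    {U : Matrix κ κ ℂ} (hU : U ∈ Matrix.unitaryGroup κ ℂ) (ψ : κ → ℂ) :
    ‖WithLp.toLp 2 (U.mulVec ψ)‖ = ‖WithLp.toLp 2 ψ‖ := by
  rw [EuclideanSpace.norm_eq, EuclideanSpace.norm_eq]
  exact congrArg _ (sum_norm_sq_mulVec hU ψ)

theorem Circuit.output_eq {m d : ℕ} (C : Circuit m d) (I : Finset (Fin m)) (x : Bits I) :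
    C.output I x = C.op.mulVec (Pi.single (join I x fun _ => false) 1) := by
  unfold Circuit.output
  congr 1
  funext z
  have : z = join I x (fun _ => false) ↔
      (fun i : I => z i) = x ∧ (fun i : Anc I => z i) = fun _ => false := by
    constructor
    · rintro rfl
      exact ⟨funext fun i => by simp [join], funext fun i => by simp [join, i.2]⟩
    · rintro ⟨h, h'⟩
      funext i
      by_cases hi : i ∈ I
      · simpa [join, hi] using congrFun h ⟨i, hi⟩
      · simpa [join, hi] using congrFun h' ⟨i, hi⟩
  simp only [tensor, basisKet, Pi.single_apply, this]
  split_ifs <;> simp_all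

theorem Circuit.output_apply {m d : ℕ} (C : Circuit m d) (I : Finset (Fin m)) (x : Bits I)
    (u : Bits (Fin m)) : C.output I x u = C.op u (join I x fun _ => false) := by
  rw [C.output_eq, Matrix.mulVec_single_one, Matrix.col_apply]

theorem Circuit.sum_norm_sq_output {m d : ℕ} (C : Circuit m d) (I : Finset (Fin m))
    (x : Bits I) : ∑ z, ‖C.output I x z‖ ^ 2 = 1 := by
  simp only [C.output_apply]
  exact sum_norm_sq_col C.op_mem_unitaryGroup _

/-- If the forward light cones of the qubits of `P` stay inside `T`, then the probability that all
the qubits of `T` are measured as `1` is controlled by the input on `P`. -/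
theorem Circuit.exists_sum_norm_sq_le {m d : ℕ} (C : Circuit m d) (P T : Finset (Fin m))
    (hP : ∀ i ∈ P, i ∉ C.back Tᶜ) :
    ∃ p : Bits (Fin m) → ℝ, (∀ v, 0 ≤ p v) ∧ ∑ v, p v = 1 ∧
      ∀ z, ∑ u with ∀ i ∈ T, u i = true, ‖C.op u z‖ ^ 2 ≤ ∑ v with ∀ i ∈ P, v i = z i, p v := by
  obtain ⟨W, V, hW, hV, sW, sV, hC⟩ := C.exists_eq_mul Tᶜ
  rw [compl_compl] at sW
  have hPT : P ⊆ T := fun i hi => by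
    by_contra h
    exact hP i hi (C.subset_back _ (Finset.mem_compl.2 h))
  -- Here `W` acts inside `T`, while `V` leaves the bits of `P` unchanged. The weight, a row of `W`,
  -- does not depend on `z`, which is what allows averaging over inputs later.
  refine ⟨fun v => ‖W (fun _ => true) v‖ ^ 2, fun v => sq_nonneg _, sum_norm_sq_row hW _,
    fun z => ?_⟩
  set K : ℝ := ∑ v with ∀ i ∈ P, v i = z i, ‖W (fun _ => true) v‖ ^ 2 with hK
  have hK0 : 0 ≤ K := Finset.sum_nonneg fun _ _ => sq_nonneg _
  -- All rows that are `1` on `T` differ by flips off `T`, to which `W` is insensitive.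
  have hrow : ∀ u : Bits (Fin m), (∀ i ∈ T, u i = true) →
      ∑ v with ∀ i ∈ P, v i = z i, ‖W u v‖ ^ 2 = K := fun u hu => by
    set s : Bits (Fin m) := fun i => !(u i) with hs
    have hs0 : ∀ i ∈ T, s i = false := fun i hi => by simp [hs, hu i hi]
    have hu' : flipBits s (fun _ => true) = u := by funext i; simp [hs]
    rw [hK, Finset.sum_filter, Finset.sum_filter, ← Equiv.sum_comp (flipBits s)]
    refine Finset.sum_congr rfl fun v _ => ?_
    conv_lhs => rw [← hu', sW.flip s hs0]
    congr 1
    exact propext (forall₂_congr fun i hi => by simp [hs0 i (hPT hi)])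
  -- Cauchy–Schwarz over the intermediate strings, which must equal `z` on `P` (by `V`) and `u` off
  -- `T` (by `W`).
  have hle : ∀ u : Bits (Fin m), (∀ i ∈ T, u i = true) →
      ‖C.op u z‖ ^ 2 ≤ K * ∑ v with ∀ i ∉ T, u i = v i, ‖V v z‖ ^ 2 := fun u hu => by
    have hsum : C.op u z = ∑ v, (if ∀ i ∈ P, v i = z i then W u v else 0) *
        (if ∀ i ∉ T, u i = v i then V v z else 0) := by
      rw [hC, Matrix.mul_apply]
      refine Finset.sum_congr rfl fun v _ => ?_
      by_cases h0 : W u v * V v z = 0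
      · rw [h0]; split_ifs <;> simp_all
      · rw [if_pos, if_pos]
        · exact sW.eq_of_ne_zero _ _ (left_ne_zero_of_mul h0)
        · exact fun i hi => sV.eq_of_ne_zero _ _ (right_ne_zero_of_mul h0) i (hP i hi)
    rw [← hrow u hu, Finset.sum_filter, Finset.sum_filter, hsum]
    calc _ ≤ (∑ v, ‖if ∀ i ∈ P, v i = z i then W u v else 0‖ *
        ‖if ∀ i ∉ T, u i = v i then V v z else 0‖) ^ 2 := by
          gcongr
          exact (norm_sum_le _ _).trans_eq (Finset.sum_congr rfl fun v _ => norm_mul _ _)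
      _ ≤ _ := Finset.sum_mul_sq_le_sq_mul_sq _ _ _
      _ = _ := by
        congr 1 <;> refine Finset.sum_congr rfl fun v _ => ?_ <;> split_ifs <;> simp
  calc _ ≤ ∑ u with ∀ i ∈ T, u i = true, K * ∑ v with ∀ i ∉ T, u i = v i, ‖V v z‖ ^ 2 :=
        Finset.sum_le_sum fun u hu => hle u (Finset.mem_filter.1 hu).2
    _ = K * ∑ v, ∑ u : Bits (Fin m) with (∀ i ∈ T, u i = true) ∧ ∀ i ∉ T, u i = v i, ‖V v z‖ ^ 2 := by
        rw [← Finset.mul_sum]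
        congr 1
        simp only [Finset.sum_filter]
        conv_rhs => rw [Finset.sum_comm]
        refine Finset.sum_congr rfl fun u _ => ?_
        by_cases hu : ∀ i ∈ T, u i = true
        · simp only [if_pos hu, and_iff_right hu]
        · rw [if_neg hu]
          exact (Finset.sum_eq_zero fun v _ => if_neg fun h => hu h.1).symm
    _ ≤ K * ∑ v, ‖V v z‖ ^ 2 := by
        gcongr with v
        rw [Finset.sum_const, nsmul_eq_mul]
        refine mul_le_of_le_one_left (sq_nonneg _) ?_
        norm_cast
        -- Given `v`, the string `u` is forced on `T` and off `T`, so each `v` is counted at most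
        -- once.
        refine Finset.card_le_one.2 fun a ha b hb => funext fun i => ?_
        rw [Finset.mem_filter] at ha hb
        by_cases hi : i ∈ T
        · rw [ha.2.1 i hi, hb.2.1 i hi]
        · rw [ha.2.2 i hi, hb.2.2 i hi]
    _ = K := by rw [sum_norm_sq_col hV, mul_one]

theorem card_bits_eq_on {m : ℕ} (I P : Finset (Fin m)) (hP : P ⊆ I) (v : Bits (Fin m)) :
    ((Finset.univ.filter fun x : Bits I => ∀ i (hi : i ∈ P), v i = x ⟨i, hP hi⟩).card : ℝ) =
      2 ^ I.card / 2 ^ P.card := by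
  have : (Finset.univ.filter fun x : Bits I => ∀ i (hi : i ∈ P), v i = x ⟨i, hP hi⟩) =
      Fintype.piFinset fun i : I => if (i : Fin m) ∈ P then {v i} else Finset.univ := by
    ext x
    simp only [Finset.mem_filter, Finset.mem_univ, true_and, Fintype.mem_piFinset]
    constructor
    · intro h i
      split_ifs with hi
      · exact Finset.mem_singleton.2 (h i hi).symm
      · exact Finset.mem_univ _
    · intro h i hi
      simpa [hi, eq_comm] using h ⟨i, hP hi⟩
  rw [this, Fintype.card_piFinset, eq_div_iff (by positivity)]
  have h2 : ∏ i : I, (if (i : Fin m) ∈ P then ({v i} : Finset Bool) else Finset.univ).card =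
      2 ^ (I \ P).card := by
    rw [Finset.prod_coe_sort I fun i => (if i ∈ P then ({v i} : Finset Bool) else .univ).card,
      ← Finset.prod_sdiff hP, Finset.prod_congr rfl (g := fun _ => 2), Finset.prod_const,
      Finset.prod_congr rfl (g := fun _ => 1), Finset.prod_const_one, mul_one]
    · intro i hi; simp [hi]
    · intro i hi; simp [(Finset.mem_sdiff.1 hi).2]
  rw [h2]
  push_cast
  rw [← pow_add, Finset.card_sdiff_add_card_eq_card hP]

/-- The average probability of measuring `1` on all the qubits of `T`. -/
theorem Circuit.sum_sum_norm_sq_le {m d : ℕ} (C : Circuit m d) (I T : Finset (Fin m)) :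
    ∑ x : Bits I, ∑ u with ∀ i ∈ T, u i = true, ‖C.output I x u‖ ^ 2 ≤
      2 ^ I.card / 2 ^ (I \ C.back Tᶜ).card := by
  set P := I \ C.back Tᶜ
  have hPI : P ⊆ I := Finset.sdiff_subset
  obtain ⟨p, hp0, hp1, hp⟩ := C.exists_sum_norm_sq_le P T fun i hi => (Finset.mem_sdiff.1 hi).2
  simp only [C.output_apply]
  calc _ ≤ ∑ x : Bits I, ∑ v with ∀ i (hi : i ∈ P), v i = x ⟨i, hPI hi⟩, p v := by
        refine Finset.sum_le_sum fun x _ => (hp _).trans_eq ?_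
        refine Finset.sum_congr (Finset.filter_congr fun v _ => forall₂_congr fun i hi => ?_)
          fun _ _ => rfl
        simp [join, hPI hi]
    _ = ∑ v, ∑ x : Bits I with ∀ i (hi : i ∈ P), v i = x ⟨i, hPI hi⟩, p v := by
        simp only [Finset.sum_filter]
        exact Finset.sum_comm
    _ = ∑ v, (2 ^ I.card / 2 ^ P.card : ℝ) * p v := by
        refine Finset.sum_congr rfl fun v _ => ?_
        rw [Finset.sum_const, nsmul_eq_mul, card_bits_eq_on]
    _ = _ := by rw [← Finset.mul_sum, hp1, mul_one]

/-! ### Removing the large gates -/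

/-- The circuit without the gates that contain at least `τ` forward light cones of inputs. -/
def Circuit.prune {m : ℕ} (I : Finset (Fin m)) (τ : ℕ) : {d : ℕ} → Circuit m d → Circuit m d
  | _, .base L => .base L
  | _, .step C M L =>
    .step (C.prune I τ) (M.filter fun T => (I \ (C.prune I τ).back Tᶜ).card < τ) L

/-- Union bound: an amplitude changes only if some removed gate fires, and then by a factor at
distance at most 2 from 1, whence the 4. -/
theorem CZLayer.sum_norm_sq_sub_le {m : ℕ} (M : CZLayer m) (p : Finset (Fin m) → Prop)
    [DecidablePred p] (φ : Ket (Fin m)) :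
    ∑ z, ‖(M.op.mulVec φ - (M.filter p).op.mulVec φ) z‖ ^ 2 ≤
      ∑ T ∈ M.supports with ¬p T, 4 * ∑ z with ∀ i ∈ T, z i = true, ‖φ z‖ ^ 2 := by
  simp only [← Finset.mul_sum]
  simp only [Finset.sum_filter (s := Finset.univ)]
  rw [Finset.sum_comm, Finset.mul_sum]
  refine Finset.sum_le_sum fun z _ => ?_
  rw [← M.filter_op_mul_filter_not_op p]
  simp only [CZLayer.op, CZLayer.filter, Matrix.diagonal_mul_diagonal, Pi.sub_apply,
    Matrix.mulVec_diagonal]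
  rw [← sub_mul, norm_mul, mul_pow, ← mul_sub_one, norm_mul, norm_prod]
  simp only [norm_czPhase, Finset.prod_const_one, one_mul]
  by_cases h : ∃ T ∈ M.supports.filter fun T => ¬p T, ∀ i ∈ T, z i = true
  · obtain ⟨T, hT, hz⟩ := h
    have h1 : ‖φ z‖ ^ 2 ≤ ∑ T ∈ M.supports with ¬p T,
        if ∀ i ∈ T, z i = true then ‖φ z‖ ^ 2 else 0 := by
      refine le_trans (by rw [if_pos hz]) (Finset.single_le_sum
        (f := fun T => if ∀ i ∈ T, z i = true then ‖φ z‖ ^ 2 else 0) (fun T _ => ?_) hT)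
      split_ifs <;> positivity
    have h2 : ‖(∏ T ∈ M.supports with ¬p T, czPhase T z) - 1‖ ≤ 2 := by
      refine (norm_sub_le _ _).trans ?_
      rw [norm_prod]
      simp [norm_czPhase]
      norm_num
    exact mul_le_mul ((pow_le_pow_left₀ (norm_nonneg _) h2 2).trans_eq (by norm_num)) h1
      (sq_nonneg _) (by norm_num)
  · rw [Finset.prod_eq_one (f := fun T => czPhase T z) fun T hT =>
      if_neg fun hz => h ⟨T, hT, hz⟩]
    simp only [sub_self, norm_zero]
    have : 0 ≤ ∑ T ∈ M.supports with ¬p T,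
        if ∀ i ∈ T, z i = true then ‖φ z‖ ^ 2 else 0 :=
      Finset.sum_nonneg fun T _ => by split_ifs <;> positivity
    nlinarith

/-- A layer has at most `|I|` gates whose supports meet `I`. -/
theorem CZLayer.card_filter_le {m : ℕ} (M : CZLayer m) (I : Finset (Fin m))
    (p : Finset (Fin m) → Prop) [DecidablePred p] (h : ∀ T, p T → (I ∩ T).Nonempty) :
    (M.supports.filter p).card ≤ I.card := by
  calc (M.supports.filter p).card ≤ ∑ T ∈ M.supports.filter p, (I ∩ T).card := by
        rw [Finset.card_eq_sum_ones]
        exact Finset.sum_le_sum fun T hT => (h T (Finset.mem_filter.1 hT).2).card_pos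
    _ = ((M.supports.filter p).biUnion fun T => I ∩ T).card := by
        refine (Finset.card_biUnion fun T hT T' hT' hne => ?_).symm
        exact (M.disjoint T (Finset.mem_of_mem_filter T hT) T' (Finset.mem_of_mem_filter T' hT')
          hne).mono Finset.inter_subset_right Finset.inter_subset_right
    _ ≤ I.card := Finset.card_le_card (Finset.biUnion_subset.2 fun T _ => Finset.inter_subset_left)

/-! ### Averages over inputs and the pruning error -/

theorem expect_mono {m : ℕ} (I : Finset (Fin m)) {f g : Bits I → ℝ} (h : ∀ x, f x ≤ g x) :
    expect I f ≤ expect I g := by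
  unfold expect
  gcongr
  exact h _

theorem expect_add {m : ℕ} (I : Finset (Fin m)) (f g : Bits I → ℝ) :
    expect I (fun x => f x + g x) = expect I f + expect I g := by
  simp [expect, Finset.sum_add_distrib, add_div]

theorem expect_const_mul {m : ℕ} (I : Finset (Fin m)) (c : ℝ) (f : Bits I → ℝ) :
    expect I (fun x => c * f x) = c * expect I f := by
  simp [expect, ← Finset.mul_sum, mul_div_assoc]

theorem expect_const {m : ℕ} (I : Finset (Fin m)) (c : ℝ) : expect I (fun _ => c) = c := by
  simp [expect]

theorem expect_sq_le {m : ℕ} (I : Finset (Fin m)) (f : Bits I → ℝ) :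
    expect I f ^ 2 ≤ expect I fun x => f x ^ 2 := by
  have := sq_sum_le_card_mul_sum_sq (s := Finset.univ) (f := f)
  simp only [Finset.card_univ, Fintype.card_pi, Fintype.card_bool, Finset.prod_const,
    Fintype.card_coe, Nat.cast_pow, Nat.cast_ofNat] at this
  unfold expect
  rw [div_pow, div_le_div_iff₀ (by positivity) (by positivity)]
  nlinarith [pow_pos (two_pos : (0 : ℝ) < 2) I.card]

/-- Removing the large gates from a layer changes the state by little on average. -/
theorem Circuit.expect_norm_layer_sub_le {m d : ℕ} (C : Circuit m d) (M : CZLayer m)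
    (I : Finset (Fin m)) (τ : ℕ) (hτ : 0 < τ) :
    expect I (fun x => ‖WithLp.toLp 2 (M.op.mulVec (C.output I x) -
      (M.filter fun T => (I \ C.back Tᶜ).card < τ).op.mulVec (C.output I x))‖) ≤
      2 * √(I.card / 2 ^ τ) := by
  have h4 : (2 : ℝ) * √(I.card / 2 ^ τ) = √(4 * (I.card / 2 ^ τ)) := by
    rw [Real.sqrt_mul (by norm_num), show (4 : ℝ) = 2 ^ 2 by norm_num,
      Real.sqrt_sq (by norm_num)]
  rw [h4]
  refine Real.le_sqrt_of_sq_le ((expect_sq_le _ _).trans ?_)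
  unfold expect
  rw [div_le_iff₀ (by positivity)]
  -- Since `τ > 0`, a removed gate contains an input, so disjointness bounds their number regardless
  -- of the number of ancillas.
  have hcard : ((M.supports.filter fun T => ¬(I \ C.back Tᶜ).card < τ).card : ℝ) ≤ I.card := by
    norm_cast
    refine M.card_filter_le I _ fun T hT => ?_
    obtain ⟨i, hi⟩ := Finset.card_pos.1 (hτ.trans_le (not_lt.1 hT))
    rw [Finset.mem_sdiff] at hi
    refine ⟨i, Finset.mem_inter.2 ⟨hi.1, ?_⟩⟩
    by_contra h
    exact hi.2 (C.subset_back _ (Finset.mem_compl.2 h))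
  calc _ ≤ ∑ x : Bits I, ∑ T ∈ M.supports with ¬(I \ C.back Tᶜ).card < τ,
        4 * ∑ z with ∀ i ∈ T, z i = true, ‖C.output I x z‖ ^ 2 := by
        refine Finset.sum_le_sum fun x _ => ?_
        rw [EuclideanSpace.norm_sq_eq]
        exact M.sum_norm_sq_sub_le _ _
    _ = ∑ T ∈ M.supports with ¬(I \ C.back Tᶜ).card < τ,
        4 * ∑ x : Bits I, ∑ z with ∀ i ∈ T, z i = true, ‖C.output I x z‖ ^ 2 := by
        rw [Finset.sum_comm]
        simp only [Finset.mul_sum]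
    _ ≤ ∑ T ∈ M.supports with ¬(I \ C.back Tᶜ).card < τ, 4 * (2 ^ I.card / 2 ^ τ : ℝ) := by
        refine Finset.sum_le_sum fun T hT => ?_
        have := not_lt.1 (Finset.mem_filter.1 hT).2
        refine mul_le_mul_of_nonneg_left ((C.sum_sum_norm_sq_le I T).trans ?_) (by norm_num)
        gcongr
        norm_num
    _ = (M.supports.filter fun T => ¬(I \ C.back Tᶜ).card < τ).card *
          (4 * (2 ^ I.card / 2 ^ τ : ℝ)) := by
        rw [Finset.sum_const, nsmul_eq_mul]
    _ ≤ I.card * (4 * (2 ^ I.card / 2 ^ τ : ℝ)) := by gcongr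
    _ = _ := by ring

theorem Circuit.output_step {m d : ℕ} (C : Circuit m d) (M : CZLayer m) (L : SingleLayer m)
    (I : Finset (Fin m)) (x : Bits I) :
    (Circuit.step C M L).output I x = L.op.mulVec (M.op.mulVec (C.output I x)) := by
  simp only [Circuit.output, Circuit.op, Matrix.mulVec_mulVec, mul_assoc]

/-- Hybrid argument: unitaries carry the earlier error along unchanged, and each layer adds its own
error, measured on the already pruned state. -/
theorem Circuit.expect_norm_output_sub_prune_le {m d : ℕ} (C : Circuit m d)
    (I : Finset (Fin m)) (τ : ℕ) (hτ : 0 < τ) :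
    expect I (fun x => ‖WithLp.toLp 2 (C.output I x - (C.prune I τ).output I x)‖) ≤
      d * (2 * √(I.card / 2 ^ τ)) := by
  induction C with
  | base L => simp [Circuit.prune, expect]
  | step C M L ih =>
    set M' := M.filter fun T => (I \ (C.prune I τ).back Tᶜ).card < τ
    have h : ∀ x, ‖WithLp.toLp 2 ((Circuit.step C M L).output I x -
        ((Circuit.step C M L).prune I τ).output I x)‖ ≤
        ‖WithLp.toLp 2 (C.output I x - (C.prune I τ).output I x)‖ +
        ‖WithLp.toLp 2 (M.op.mulVec ((C.prune I τ).output I x) -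
          M'.op.mulVec ((C.prune I τ).output I x))‖ := fun x => by
      rw [Circuit.prune, Circuit.output_step, Circuit.output_step, ← Matrix.mulVec_sub,
        norm_mulVec_of_mem_unitaryGroup L.op_mem_unitaryGroup,
        ← norm_mulVec_of_mem_unitaryGroup M.op_mem_unitaryGroup
          (C.output I x - (C.prune I τ).output I x), Matrix.mulVec_sub]
      refine le_trans (le_of_eq ?_) (norm_add_le _ _)
      rw [← WithLp.toLp_add, sub_add_sub_cancel]
    refine (expect_mono I h).trans ?_
    rw [expect_add]
    refine (add_le_add ih ((C.prune I τ).expect_norm_layer_sub_le M I τ hτ)).trans_eq ?_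
    push_cast
    ring

/-! ### Light cones of pruned circuits -/

theorem CZLayer.spread_union {m : ℕ} (M : CZLayer m) (S S' : Finset (Fin m)) :
    M.spread (S ∪ S') = M.spread S ∪ M.spread S' := by
  ext i
  simp only [CZLayer.mem_spread, Finset.mem_union, Finset.disjoint_union_right]
  grind

theorem Circuit.back_union {m d : ℕ} (C : Circuit m d) (S S' : Finset (Fin m)) :
    C.back (S ∪ S') = C.back S ∪ C.back S' := by
  induction C generalizing S S' with
  | base L => rfl
  | step C M L ih => simp only [Circuit.back, CZLayer.spread_union, ih]

theorem Circuit.back_mono {m d : ℕ} (C : Circuit m d) {S S' : Finset (Fin m)} (h : S ⊆ S') :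
    C.back S ⊆ C.back S' := by
  rw [← Finset.union_eq_right.2 h, C.back_union]
  exact Finset.subset_union_left

/-- Every point of the spread is joined to a point of `S` by a segment inside the spread, because
supports are intervals. -/
theorem CZLayer.ordConnected_spread {m : ℕ} (M : CZLayer m) {S : Finset (Fin m)}
    (hS : (S : Set (Fin m)).OrdConnected) : (M.spread S : Set (Fin m)).OrdConnected := by
  have key : ∀ a ∈ M.spread S, ∃ p ∈ S, ∀ c, (a ≤ c ∧ c ≤ p ∨ p ≤ c ∧ c ≤ a) →
      c ∈ M.spread S := by
    intro a ha
    rcases CZLayer.mem_spread.1 ha with h | ⟨T, hT, hTS, haT⟩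
    · exact ⟨a, h, fun c hc => (show c = a by grind) ▸ ha⟩
    · obtain ⟨p, hpT, hpS⟩ := Finset.not_disjoint_iff.1 hTS
      refine ⟨p, hpS, fun c hc => CZLayer.mem_spread.2 (Or.inr ⟨T, hT, hTS, ?_⟩)⟩
      obtain ⟨u, v, -, rfl⟩ := M.interval T hT
      rw [Finset.mem_Icc] at *
      rcases hc with hc | hc
      · exact ⟨haT.1.trans hc.1, hc.2.trans hpT.2⟩
      · exact ⟨hpT.1.trans hc.1, hc.2.trans haT.2⟩
  refine ⟨fun a ha b hb c hc => ?_⟩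
  obtain ⟨p, hp, hap⟩ := key a ha
  obtain ⟨q, hq, hbq⟩ := key b hb
  rcases le_total c p with h | h
  · exact hap c (Or.inl ⟨hc.1, h⟩)
  rcases le_total c q with h' | h'
  · exact M.subset_spread S (hS.out hp hq ⟨h, h'⟩)
  · exact hbq c (Or.inr ⟨h', hc.2⟩)

theorem Circuit.ordConnected_back {m d : ℕ} (C : Circuit m d) {S : Finset (Fin m)}
    (hS : (S : Set (Fin m)).OrdConnected) : (C.back S : Set (Fin m)).OrdConnected := by
  induction C generalizing S with
  | base L => exact hS
  | step C M L ih => exact ih (M.ordConnected_spread hS)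

/-- The qubits on the left of the cut before position `k`. -/
def leftOf (m k : ℕ) : Finset (Fin m) := Finset.univ.filter fun i => (i : ℕ) < k

/-- The qubits on the right of the cut before position `k`. -/
def rightOf (m k : ℕ) : Finset (Fin m) := Finset.univ.filter fun i => k ≤ (i : ℕ)

@[simp]
theorem mem_leftOf {m k : ℕ} {i : Fin m} : i ∈ leftOf m k ↔ (i : ℕ) < k := by simp [leftOf]

@[simp]
theorem mem_rightOf {m k : ℕ} {i : Fin m} : i ∈ rightOf m k ↔ k ≤ (i : ℕ) := by simp [rightOf]

/-- The inputs whose forward light cones meet both sides of a cut. -/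
def Circuit.crossing {m d : ℕ} (C : Circuit m d) (I : Finset (Fin m)) (k : ℕ) : Finset (Fin m) :=
  I ∩ (C.back (leftOf m k) ∩ C.back (rightOf m k))

/-- A forward cone that leaves `[a, b]` to the left crosses the cut at `a`, since it also meets the
right side of that cut; symmetrically, one leaving to the right crosses the cut at `b + 1`. -/
theorem Circuit.card_inter_back_le {m d : ℕ} (C : Circuit m d) (I : Finset (Fin m))
    (a b : Fin m) :
    (I ∩ (C.back (leftOf m (b + 1)) ∩ C.back (rightOf m a))).card ≤
      (I \ C.back (Finset.Icc a b)ᶜ).card + (C.crossing I a).card +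
        (C.crossing I (b + 1)).card := by
  have hc : (Finset.Icc a b)ᶜ = leftOf m a ∪ rightOf m (b + 1) := by
    ext i
    simp only [Finset.mem_compl, Finset.mem_Icc, Finset.mem_union, mem_leftOf, mem_rightOf,
      Fin.le_def]
    omega
  refine (Finset.card_le_card (t := (I \ C.back (Finset.Icc a b)ᶜ ∪ C.crossing I a) ∪
    C.crossing I (b + 1)) fun q hq => ?_).trans
    ((Finset.card_union_le _ _).trans (Nat.add_le_add_right (Finset.card_union_le _ _) _))
  rw [hc, C.back_union]
  simp only [Circuit.crossing, Finset.mem_union, Finset.mem_inter, Finset.mem_sdiff] at hq ⊢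
  tauto

/-- A last-layer gate `[a, b]` over the cut lets in only inputs that crossed at `a` or `b + 1` one
layer earlier, or whose cones lay inside it, and pruning leaves fewer than `τ` of the latter. The
recursion x ↦ 2x + τ becomes doubling once `τ` is added to the count. -/
theorem Circuit.card_crossing_prune_add_le {m d : ℕ} (C : Circuit m d) (I : Finset (Fin m))
    (τ k : ℕ) : ((C.prune I τ).crossing I k).card + τ ≤ 2 ^ d * τ := by
  induction C generalizing k with
  | base L =>
    have : leftOf m k ∩ rightOf m k = ∅ := by
      ext i
      simp
    simp [Circuit.crossing, Circuit.prune, Circuit.back, this]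
  | @step d C M L ih =>
    set C' := C.prune I τ
    set M' := M.filter fun T => (I \ C'.back Tᶜ).card < τ
    change (I ∩ (C'.back (M'.spread (leftOf m k)) ∩ C'.back (M'.spread (rightOf m k)))).card +
      τ ≤ _
    by_cases h : ∃ T ∈ M'.supports, ¬Disjoint T (leftOf m k) ∧ ¬Disjoint T (rightOf m k)
    · obtain ⟨T, hT, hl, hr⟩ := h
      have hcard := (Finset.mem_filter.1 hT).2
      obtain ⟨a, b, hab, rfl⟩ := M'.interval T hT
      obtain ⟨p, hp, hp'⟩ := Finset.not_disjoint_iff.1 hl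
      obtain ⟨q, hq, hq'⟩ := Finset.not_disjoint_iff.1 hr
      simp only [Finset.mem_Icc, mem_leftOf, mem_rightOf, Fin.le_def] at hp hp' hq hq'
      -- A gate meeting the left side and reaching past `b` would contain `b`, hence coincide with
      -- `[a, b]` by disjointness.
      have h1 : M'.spread (leftOf m k) ⊆ leftOf m (b + 1) := by
        intro i hi
        rw [mem_leftOf]
        rcases CZLayer.mem_spread.1 hi with hi | ⟨T', hT', hd, hi⟩
        · rw [mem_leftOf] at hi
          omega
        · by_contra hlt
          obtain ⟨a', b', -, rfl⟩ := M'.interval T' hT'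
          obtain ⟨r, hr, hr'⟩ := Finset.not_disjoint_iff.1 hd
          simp only [Finset.mem_Icc, mem_leftOf, Fin.le_def] at hr hr' hi
          have hb : b ∈ Finset.Icc a' b' := by
            simp only [Finset.mem_Icc, Fin.le_def]
            omega
          have heq : Finset.Icc a b = Finset.Icc a' b' := by
            by_contra hne
            exact Finset.disjoint_left.1 (M'.disjoint _ hT _ hT' hne)
              (Finset.right_mem_Icc.2 hab) hb
          have : i ∈ Finset.Icc a b := heq ▸ Finset.mem_Icc.2 hi
          simp only [Finset.mem_Icc, Fin.le_def] at this
          omega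
      have h2 : M'.spread (rightOf m k) ⊆ rightOf m a := by
        intro i hi
        rw [mem_rightOf]
        rcases CZLayer.mem_spread.1 hi with hi | ⟨T', hT', hd, hi⟩
        · rw [mem_rightOf] at hi
          omega
        · by_contra hlt
          obtain ⟨a', b', -, rfl⟩ := M'.interval T' hT'
          obtain ⟨r, hr, hr'⟩ := Finset.not_disjoint_iff.1 hd
          simp only [Finset.mem_Icc, mem_rightOf, Fin.le_def] at hr hr' hi
          have hb : a ∈ Finset.Icc a' b' := by
            simp only [Finset.mem_Icc, Fin.le_def]
            omega
          have heq : Finset.Icc a b = Finset.Icc a' b' := by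
            by_contra hne
            exact Finset.disjoint_left.1 (M'.disjoint _ hT _ hT' hne)
              (Finset.left_mem_Icc.2 hab) hb
          have : i ∈ Finset.Icc a b := heq ▸ Finset.mem_Icc.2 hi
          simp only [Finset.mem_Icc, Fin.le_def] at this
          omega
      have h3 := Finset.card_le_card (Finset.inter_subset_inter (subset_refl I)
        (Finset.inter_subset_inter (C'.back_mono h1) (C'.back_mono h2)))
      have h4 := C'.card_inter_back_le I a b
      have h5 := ih a
      have h6 := ih (b + 1)
      rw [pow_succ]
      nlinarith
    · push Not at h
      have h1 : M'.spread (leftOf m k) ⊆ leftOf m k := by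
        intro i hi
        rcases CZLayer.mem_spread.1 hi with hi | ⟨T, hT, hd, hi⟩
        · exact hi
        · have := Finset.disjoint_left.1 (h T hT hd) hi
          rw [mem_rightOf] at this
          rw [mem_leftOf]
          omega
      have h2 : M'.spread (rightOf m k) ⊆ rightOf m k := by
        intro i hi
        rcases CZLayer.mem_spread.1 hi with hi | ⟨T, hT, hd, hi⟩
        · exact hi
        · by_contra hlt
          refine hd (h T hT (Finset.not_disjoint_iff.2 ⟨i, hi, ?_⟩))
          rw [mem_rightOf] at hlt
          rw [mem_leftOf]
          omega
      have h3 := Finset.card_le_card (Finset.inter_subset_inter (subset_refl I)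
        (Finset.inter_subset_inter (C'.back_mono h1) (C'.back_mono h2)))
      have h5 : (I ∩ (C'.back (leftOf m k) ∩ C'.back (rightOf m k))).card + τ ≤ 2 ^ d * τ := ih k
      rw [pow_succ]
      nlinarith

/-- The interval estimate with `a = b = i`: at most one cone lies inside `{i}`, and the others cross
one of the two adjacent cuts. -/
theorem Circuit.card_inter_back_singleton_le {m d : ℕ} (C : Circuit m d) (I : Finset (Fin m))
    (τ : ℕ) (hτ : 0 < τ) (i : Fin m) :
    (I ∩ (C.prune I τ).back {i}).card ≤ 2 ^ (d + 1) * τ := by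
  set C' := C.prune I τ
  have h1 := C'.card_inter_back_le I i i
  have h2 := C.card_crossing_prune_add_le I τ i
  have h3 := C.card_crossing_prune_add_le I τ (i + 1)
  have h4 : (I ∩ C'.back {i}).card ≤
      (I ∩ (C'.back (leftOf m (i + 1)) ∩ C'.back (rightOf m i))).card :=
    Finset.card_le_card (Finset.inter_subset_inter subset_rfl (Finset.subset_inter
      (C'.back_mono (by simp)) (C'.back_mono (by simp))))
  have h5 : (I \ C'.back (Finset.Icc i i)ᶜ).card ≤ 1 := by
    rw [Finset.Icc_self]
    refine (Finset.card_le_card (t := {i}) fun j hj => ?_).trans_eq (Finset.card_singleton i)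
    by_contra h
    exact (Finset.mem_sdiff.1 hj).2 (C'.subset_back _ (Finset.mem_compl.2 h))
  rw [pow_succ]
  change (C'.crossing I i).card + τ ≤ _ at h2
  change (C'.crossing I (i + 1)).card + τ ≤ _ at h3
  nlinarith

/-- If there are many inputs, the light cones of two inputs are disjoint in the pruned circuit. -/
theorem Circuit.exists_disjoint_back {m d : ℕ} (C : Circuit m d) (I : Finset (Fin m)) (τ : ℕ)
    (hτ : 0 < τ) (hI : 2 ^ (d + 2) * τ < I.card) :
    ∃ i ∈ I, ∃ j ∈ I, Disjoint ((C.prune I τ).back {i}) ((C.prune I τ).back {j}) := by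
  have hne : I.Nonempty := Finset.card_pos.1 (by omega)
  set C' := C.prune I τ
  -- Each cone is an interval containing its own qubit, so if the cones of the extreme inputs met,
  -- together they would cover `I`.
  refine ⟨I.min' hne, I.min'_mem hne, I.max' hne, I.max'_mem hne, ?_⟩
  by_contra hd
  obtain ⟨q, hq, hq'⟩ := Finset.not_disjoint_iff.1 hd
  have hoc : ∀ i, (C'.back {i} : Set (Fin m)).OrdConnected := fun i =>
    C'.ordConnected_back (by simpa using Set.ordConnected_singleton)
  have hsub : I ⊆ I ∩ C'.back {I.min' hne} ∪ I ∩ C'.back {I.max' hne} := fun p hp => by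
    rw [← Finset.inter_union_distrib_left, Finset.mem_inter, Finset.mem_union]
    refine ⟨hp, ?_⟩
    rcases le_total p q with h | h
    · exact Or.inl ((hoc _).out (C'.subset_back _ (Finset.mem_singleton_self _)) hq
        ⟨I.min'_le p hp, h⟩)
    · exact Or.inr ((hoc _).out hq' (C'.subset_back _ (Finset.mem_singleton_self _))
        ⟨h, I.le_max' p hp⟩)
  have h1 := (Finset.card_le_card hsub).trans (Finset.card_union_le _ _)
  have h2 := C.card_inter_back_singleton_le I τ hτ (I.min' hne)
  have h3 := C.card_inter_back_singleton_le I τ hτ (I.max' hne)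
  have h4 : 2 ^ (d + 2) * τ = 2 ^ (d + 1) * τ + 2 ^ (d + 1) * τ := by ring
  change (I ∩ C'.back _).card ≤ _ at h2 h3
  omega

/-! ### Correlations and the trace norm -/

/-- The eigenvalue of the Pauli operator `Z` at a bit. -/
def sign (b : Bool) : ℝ := if b then -1 else 1

theorem sign_not (b : Bool) : sign (!b) = -sign b := by cases b <;> simp [sign]

theorem abs_sign (b : Bool) : |sign b| = 1 := by cases b <;> simp [sign]

/-- The Pauli operator `Z` on the qubit `i`. -/
def pauliZ {m : ℕ} (i : Fin m) : Op (Fin m) := Matrix.diagonal fun z => (sign (z i) : ℂ)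

theorem supportedOn_pauliZ {m : ℕ} (i : Fin m) : SupportedOn {i} (pauliZ i) := by
  refine ⟨fun z w hzw j _ => ?_, fun s hs z w => ?_⟩
  · by_contra hne
    exact hzw (Matrix.diagonal_apply_ne _ fun h => hne (congrFun h j))
  · by_cases hzw : z = w
    · subst hzw
      simp [pauliZ, hs i (Finset.mem_singleton_self i)]
    · rw [pauliZ, Matrix.diagonal_apply_ne _ hzw,
        Matrix.diagonal_apply_ne _ fun h => hzw ((flipBits s).injective h)]

theorem SupportedOn.star {V : Type*} {S : Finset V} {A : Op V} (hA : SupportedOn S A) :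
    SupportedOn S (star A) := by
  refine ⟨fun z w h i hi => (hA.eq_of_ne_zero w z (fun h0 => h ?_) i hi).symm,
    fun s hs z w => ?_⟩
  · rw [Matrix.star_apply, h0, star_zero]
  · rw [Matrix.star_apply, hA.flip s hs, Matrix.star_apply]

/-- In `C.op = W * V` the factor `W` avoids `i`, so it commutes with `pauliZ i` and cancels against
its adjoint. -/
theorem Circuit.supportedOn_heisenberg {m d : ℕ} (C : Circuit m d) (i : Fin m) :
    SupportedOn (C.back {i}) (star C.op * pauliZ i * C.op) := by
  obtain ⟨W, V, hW, -, sW, sV, hC⟩ := C.exists_eq_mul {i}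
  have h : star C.op * pauliZ i * C.op = Star.star V * pauliZ i * V := by
    calc star C.op * pauliZ i * C.op = Star.star V * (Star.star W * (pauliZ i * W)) * V := by
          rw [hC, star_mul]; simp only [mul_assoc]
      _ = Star.star V * (Star.star W * W * pauliZ i) * V := by
          rw [(supportedOn_pauliZ i).mul_comm sW disjoint_compl_right]
          simp only [mul_assoc]
      _ = _ := by rw [Matrix.mem_unitaryGroup_iff'.1 hW, one_mul]
  rw [h]
  exact (sV.star.mul ((supportedOn_pauliZ i).mono (C.subset_back _))).mul sV

theorem star_mul_diagonal_mul_apply {κ : Type*} [Fintype κ] [DecidableEq κ] (U : Matrix κ κ ℂ)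
    (g : κ → ℝ) (z : κ) :
    (star U * Matrix.diagonal (fun k => (g k : ℂ)) * U) z z =
      ((∑ u, g u * ‖U u z‖ ^ 2 : ℝ) : ℂ) := by
  rw [Matrix.mul_apply]
  push_cast
  refine Finset.sum_congr rfl fun u _ => ?_
  rw [Matrix.mul_diagonal, Matrix.star_apply, ← Complex.conj_mul', RCLike.star_def]
  ring

/-- Output bits with disjoint light cones are uncorrelated. -/
theorem Circuit.sum_sign_mul_sign {m d : ℕ} (C : Circuit m d) {i j : Fin m}
    (h : Disjoint (C.back {i}) (C.back {j})) (z : Bits (Fin m)) :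
    ∑ u, sign (u i) * sign (u j) * ‖C.op u z‖ ^ 2 =
      (∑ u, sign (u i) * ‖C.op u z‖ ^ 2) * ∑ u, sign (u j) * ‖C.op u z‖ ^ 2 := by
  have hU := C.op_mem_unitaryGroup
  have e : star C.op * Matrix.diagonal (fun u => ((sign (u i) * sign (u j) : ℝ) : ℂ)) * C.op =
      (star C.op * pauliZ i * C.op) * (star C.op * pauliZ j * C.op) := by
    calc _ = star C.op * (pauliZ i * pauliZ j) * C.op := by
          simp only [pauliZ, Matrix.diagonal_mul_diagonal, Complex.ofReal_mul]
      _ = star C.op * (pauliZ i * (C.op * star C.op) * pauliZ j) * C.op := by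
          rw [Matrix.mem_unitaryGroup_iff.1 hU, mul_one]
      _ = _ := by simp only [mul_assoc]
  have e' := congrFun (congrFun e z) z
  rw [star_mul_diagonal_mul_apply, Matrix.mul_apply,
    Finset.sum_eq_single (M := ℂ) (s := Finset.univ) z] at e'
  · rw [pauliZ, pauliZ, star_mul_diagonal_mul_apply, star_mul_diagonal_mul_apply] at e'
    exact_mod_cast e'
  -- A contributing `w` agrees with `z` off each of two disjoint cones, hence everywhere.
  · intro w _ hw
    by_contra h0
    refine hw (funext fun k => ?_)
    by_cases hk : k ∈ C.back {i}
    · exact (C.supportedOn_heisenberg j).eq_of_ne_zero _ _ (right_ne_zero_of_mul h0) k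
        (Finset.disjoint_left.1 h hk)
    · exact ((C.supportedOn_heisenberg i).eq_of_ne_zero _ _ (left_ne_zero_of_mul h0) k hk).symm
  · simp

/-! ### Trace norm and diagonal observables -/

theorem traceNorm_nonneg {κ : Type*} [Fintype κ] [DecidableEq κ] (M : Matrix κ κ ℂ) :
    0 ≤ traceNorm M :=
  Finset.sum_nonneg fun _ _ => Real.sqrt_nonneg _

/-- The trace norm bounds the expectations of diagonal contractions. -/
theorem norm_sum_mul_diag_le_traceNorm {κ : Type*} [Fintype κ] [DecidableEq κ]
    (M : Matrix κ κ ℂ) (g : κ → ℝ) (hg : ∀ k, |g k| ≤ 1) :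
    ‖∑ k, (g k : ℂ) * M k k‖ ≤ traceNorm M := by
  set hA := Matrix.isHermitian_conjTranspose_mul_self M
  set U : Matrix κ κ ℂ := (hA.eigenvectorUnitary : Matrix κ κ ℂ)
  have hU : U ∈ Matrix.unitaryGroup κ ℂ := hA.eigenvectorUnitary.2
  -- In an eigenbasis of `M† M` the columns of `M * U` have the singular values as lengths;
  -- Cauchy–Schwarz is applied column by column.
  set N := M * U with hN
  have hNN : N.conjTranspose * N = Matrix.diagonal fun k => (hA.eigenvalues k : ℂ) := by
    have h := hA.spectral_theorem
    rw [hN, Matrix.conjTranspose_mul, Matrix.mul_assoc, ← Matrix.mul_assoc _ M U,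
      ← Matrix.star_eq_conjTranspose U]
    have h' : M.conjTranspose * M =
        U * Matrix.diagonal (fun k => (hA.eigenvalues k : ℂ)) * star U := by
      conv_lhs => rw [h]
      rfl
    calc star U * (M.conjTranspose * M * U) = (star U * U) * Matrix.diagonal (fun k => (hA.eigenvalues k : ℂ)) *
        (star U * U) := by
          conv_lhs => enter [2, 1]; rw [h']
          simp only [Matrix.mul_assoc]
      _ = _ := by rw [Matrix.mem_unitaryGroup_iff'.1 hU, one_mul, mul_one]
  have hcol : ∀ k, ∑ j, ‖N j k‖ ^ 2 = hA.eigenvalues k := fun k => by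
    have := congrFun (congrFun hNN k) k
    rw [Matrix.mul_apply, Matrix.diagonal_apply_eq] at this
    simp only [Matrix.conjTranspose_apply, RCLike.star_def, Complex.conj_mul'] at this
    exact_mod_cast this
  have hM : M = N * star U := by
    rw [hN, Matrix.mul_assoc, Matrix.mem_unitaryGroup_iff.1 hU, Matrix.mul_one]
  calc ‖∑ j, (g j : ℂ) * M j j‖ = ‖∑ k, ∑ j, (g j : ℂ) * (N j k * star (U j k))‖ := by
        rw [Finset.sum_comm]
        congr 1
        refine Finset.sum_congr rfl fun j _ => ?_
        rw [hM, Matrix.mul_apply, Finset.mul_sum]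
        rfl
    _ ≤ ∑ k, ∑ j, ‖N j k‖ * ‖U j k‖ := by
        refine (norm_sum_le _ _).trans (Finset.sum_le_sum fun k _ =>
          (norm_sum_le _ _).trans (Finset.sum_le_sum fun j _ => ?_))
        rw [norm_mul, norm_mul, norm_star, Complex.norm_real]
        exact mul_le_of_le_one_left (by positivity) (hg j)
    _ ≤ ∑ k, Real.sqrt (hA.eigenvalues k) := by
        refine Finset.sum_le_sum fun k _ => (Real.sum_mul_le_sqrt_mul_sqrt _ _ _).trans_eq ?_
        rw [hcol, sum_norm_sq_col hU, Real.sqrt_one, mul_one]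

theorem sum_join {m : ℕ} (I : Finset (Fin m)) (f : Bits (Fin m) → ℝ) :
    ∑ y : Bits I, ∑ a : Bits (Anc I), f (join I y a) = ∑ z, f z := by
  rw [← Fintype.sum_prod_type']
  exact Equiv.sum_comp (Equiv.piEquivPiSubtypeProd (fun i => i ∈ I) fun _ => Bool).symm f

theorem traceAnc_proj_apply_self {m : ℕ} (I : Finset (Fin m)) (ψ : Ket (Fin m)) (y : Bits I) :
    traceAnc I (proj ψ) y y = ((∑ a : Bits (Anc I), ‖ψ (join I y a)‖ ^ 2 : ℝ) : ℂ) := by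
  simp [traceAnc, proj, Matrix.vecMulVec_apply, Complex.mul_conj']

theorem join_restrict {m : ℕ} (I : Finset (Fin m)) (y : Bits I) (a : Bits (Anc I)) :
    (fun i : I => join I y a i) = y :=
  funext fun i => by simp [join]

theorem join_restrict_anc {m : ℕ} (I : Finset (Fin m)) (y : Bits I) (a : Bits (Anc I)) :
    (fun i : Anc I => join I y a i) = a :=
  funext fun i => by simp [join, i.2]

theorem sum_mul_traceAnc_proj {m : ℕ} (I : Finset (Fin m)) (ψ : Ket (Fin m))
    (g : Bits I → ℝ) :
    ∑ y, (g y : ℂ) * traceAnc I (proj ψ) y y =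
      ((∑ z, g (fun i => z i) * ‖ψ z‖ ^ 2 : ℝ) : ℂ) := by
  rw [← sum_join I]
  simp only [join_restrict, traceAnc_proj_apply_self, ← Finset.mul_sum]
  push_cast
  rfl

/-- Factor |ψ|² - |φ|² as a difference of squares and apply Cauchy–Schwarz against each unit vector.
-/
theorem abs_sum_mul_sub_le {κ : Type*} [Fintype κ] (ψ φ : κ → ℂ)
    (hψ : ∑ z, ‖ψ z‖ ^ 2 = 1) (hφ : ∑ z, ‖φ z‖ ^ 2 = 1) (g : κ → ℝ) (hg : ∀ k, |g k| ≤ 1) :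
    |∑ z, g z * ‖ψ z‖ ^ 2 - ∑ z, g z * ‖φ z‖ ^ 2| ≤ 2 * ‖WithLp.toLp 2 (ψ - φ)‖ := by
  have key : ∀ χ : κ → ℂ, ∑ z, ‖χ z‖ ^ 2 = 1 →
      ∑ z, ‖(ψ - φ) z‖ * ‖χ z‖ ≤ ‖WithLp.toLp 2 (ψ - φ)‖ := fun χ hχ => by
    refine (Real.sum_mul_le_sqrt_mul_sqrt _ _ _).trans_eq ?_
    rw [hχ, Real.sqrt_one, mul_one, EuclideanSpace.norm_eq]
  rw [← Finset.sum_sub_distrib]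
  calc _ ≤ ∑ z, (‖(ψ - φ) z‖ * ‖ψ z‖ + ‖(ψ - φ) z‖ * ‖φ z‖) := by
        refine (Finset.abs_sum_le_sum_abs _ _).trans (Finset.sum_le_sum fun z _ => ?_)
        rw [← mul_sub, sq_sub_sq, abs_mul, abs_mul, ← mul_add, mul_comm |‖ψ z‖ + ‖φ z‖|,
          abs_of_nonneg (add_nonneg (norm_nonneg (ψ z)) (norm_nonneg (φ z)))]
        exact (mul_le_of_le_one_left (by positivity) (hg z)).trans
          (mul_le_mul_of_nonneg_right (abs_norm_sub_norm_le _ _) (by positivity))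
    _ ≤ _ := by
        rw [Finset.sum_add_distrib]
        linarith [key ψ hψ, key φ hφ]

/-! ### Cat and nekomata statistics -/

/-- The computational basis measurement of `σ` gives `x` and `x̄` with probability `1/2` each. -/
def HasCatDiagonal {m : ℕ} (I : Finset (Fin m)) (x : Bits I) (σ : Op I) : Prop :=
  ∀ y, σ y y = ((if y = x then 1 else 0) + if y = compl x then 1 else 0) / 2

theorem compl_ne {m : ℕ} {I : Finset (Fin m)} (hI : I.Nonempty) (x : Bits I) : compl x ≠ x := by
  obtain ⟨i, hi⟩ := hI
  intro h
  simpa [compl] using congrFun h ⟨i, hi⟩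

theorem norm_inv_sqrt_two_sq : ‖((Real.sqrt 2 : ℝ) : ℂ)⁻¹‖ ^ 2 = 1 / 2 := by
  rw [norm_inv, Complex.norm_real, inv_pow, Real.norm_of_nonneg (Real.sqrt_nonneg _),
    Real.sq_sqrt (by norm_num), one_div]

theorem hasCatDiagonal_nekomata {m : ℕ} (I : Finset (Fin m)) (hI : I.Nonempty) (x : Bits I)
    (ψ₀ ψ₁ : Ket (Anc I)) (h₀ : IsUnitKet ψ₀) (h₁ : IsUnitKet ψ₁) :
    HasCatDiagonal I x (traceAnc I (proj (nekomataKet I x ψ₀ ψ₁))) := by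
  intro y
  have hne := compl_ne hI x
  rw [traceAnc_proj_apply_self]
  simp only [nekomataKet, Pi.smul_apply, Pi.add_apply, tensor, join_restrict, join_restrict_anc,
    basisKet, smul_eq_mul, norm_mul, mul_pow, norm_inv_sqrt_two_sq]
  rw [← Finset.mul_sum]
  by_cases h : y = x
  · subst h
    simp only [if_true, if_neg hne.symm, one_mul, zero_mul, add_zero]
    rw [h₀]
    push_cast
    ring
  · by_cases h' : y = compl x
    · subst h'
      simp only [if_true, if_neg hne, one_mul, zero_mul, zero_add]
      rw [h₁]
      push_cast
      ring
    · simp [h, h']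

theorem hasCatDiagonal_cat {m : ℕ} (I : Finset (Fin m)) (hI : I.Nonempty) (x : Bits I) :
    HasCatDiagonal I x (proj (catKet I x)) := by
  intro y
  have hne := compl_ne hI x
  have hy : proj (catKet I x) y y = ((‖catKet I x y‖ ^ 2 : ℝ) : ℂ) := by
    simp [proj, Matrix.vecMulVec_apply, Complex.mul_conj']
  rw [hy]
  simp only [catKet, Pi.smul_apply, Pi.add_apply, basisKet, smul_eq_mul, norm_mul, mul_pow,
    norm_inv_sqrt_two_sq]
  by_cases h : y = x
  · subst h
    simp [hne.symm]
  · by_cases h' : y = compl x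
    · subst h'
      simp [hne]
    · simp [h, h']

theorem HasCatDiagonal.sum_mul {m : ℕ} {I : Finset (Fin m)} {x : Bits I} {σ : Op I}
    (h : HasCatDiagonal I x σ) (g : Bits I → ℝ) :
    ∑ y, (g y : ℂ) * σ y y = (((g x + g (compl x)) / 2 : ℝ) : ℂ) := by
  simp only [h _, mul_div_assoc', mul_add, mul_ite, mul_one, mul_zero, ← Finset.sum_div,
    Finset.sum_add_distrib, Finset.sum_ite_eq', Finset.mem_univ, if_true]
  push_cast
  rfl

/-- A circuit whose output is close to that of a circuit with two uncorrelated outputs is far from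
nekomata states. -/
theorem three_fifths_le_traceNorm_add {m d d' : ℕ} (C : Circuit m d) (C' : Circuit m d')
    (I : Finset (Fin m)) {i j : Fin m} (hi : i ∈ I) (hj : j ∈ I)
    (h : Disjoint (C'.back {i}) (C'.back {j})) (x : Bits I) (σ : Op I)
    (hσ : HasCatDiagonal I x σ) :
    3 / 5 ≤ traceNorm (traceAnc I (proj (C.output I x)) - σ) +
      2 * ‖WithLp.toLp 2 (C.output I x - C'.output I x)‖ := by
  set G := traceNorm (traceAnc I (proj (C.output I x)) - σ) +
    2 * ‖WithLp.toLp 2 (C.output I x - C'.output I x)‖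
  have key : ∀ g : Bits I → ℝ, (∀ y, |g y| ≤ 1) →
      |∑ z, g (fun i => z i) * ‖C'.output I x z‖ ^ 2 - (g x + g (compl x)) / 2| ≤ G := by
    intro g hg
    have h1 := norm_sum_mul_diag_le_traceNorm (traceAnc I (proj (C.output I x)) - σ) g hg
    simp only [Matrix.sub_apply, mul_sub, Finset.sum_sub_distrib] at h1
    rw [sum_mul_traceAnc_proj, hσ.sum_mul, ← Complex.ofReal_sub, Complex.norm_real,
      Real.norm_eq_abs] at h1
    have h2 := abs_sum_mul_sub_le _ _ (C.sum_norm_sq_output I x) (C'.sum_norm_sq_output I x)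
      (fun z => g fun i => z i) fun _ => hg _
    rw [abs_sub_comm] at h2
    exact (abs_sub_le _ _ _).trans ((add_le_add h2 h1).trans_eq (add_comm _ _))
  have hi' := key (fun y => sign (y ⟨i, hi⟩)) fun y => (abs_sign _).le
  have hj' := key (fun y => sign (y ⟨j, hj⟩)) fun y => (abs_sign _).le
  have hij := key (fun y => sign (y ⟨i, hi⟩) * sign (y ⟨j, hj⟩)) fun y => by
    rw [abs_mul, abs_sign, abs_sign, one_mul]
  simp only [compl, sign_not, add_neg_cancel, zero_div, sub_zero, neg_mul_neg,
    add_self_div_two, C'.output_apply] at hi' hj' hij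
  rw [C'.sum_sign_mul_sign h] at hij
  set a := ∑ u, sign (u i) * ‖C'.op u (join I x fun _ => false)‖ ^ 2
  set b := ∑ u, sign (u j) * ‖C'.op u (join I x fun _ => false)‖ ^ 2
  have h1 : 1 ≤ |a * b| + G := by
    have h3 : |sign (x ⟨i, hi⟩) * sign (x ⟨j, hj⟩)| = 1 := by
      rw [abs_mul, abs_sign, abs_sign, one_mul]
    have h4 := abs_sub_abs_le_abs_sub (sign (x ⟨i, hi⟩) * sign (x ⟨j, hj⟩)) (a * b)
    rw [abs_sub_comm] at h4
    linarith
  have h2 : |a * b| ≤ G * G := by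
    rw [abs_mul]
    exact mul_le_mul hi' hj' (abs_nonneg _) ((abs_nonneg _).trans hi')
  have h0 : 0 ≤ G := (abs_nonneg _).trans hi'
  -- The bounds give 1 ≤ G + G², which fails below 3/5 because 3/5 + 9/25 < 1.
  by_contra hlt
  nlinarith

/-! ### Choice of parameters -/

theorem Circuit.le_expect_traceNorm {n d : ℕ} {ε t : ℝ} (hn : 1 ≤ n) (hd : 1 ≤ d) (hε : 0 < ε)
    (ht : t = Real.logb 2 ((n : ℝ) / ε)) {m : ℕ} (I : Finset (Fin m)) (hI : I.card = n)
    (C : Circuit m d) (σ : Bits I → Op I) (hσ : ∀ x, HasCatDiagonal I x (σ x)) :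
    1 / 8 - (2 : ℝ) ^ (-(1 / 8 * ((n : ℝ) / t ^ d - 1))) - 16 * (d : ℝ) * ε ≤
      expect I fun x => traceNorm (traceAnc I (proj (C.output I x)) - σ x) := by
  -- Only a positive lower bound needs proof; positivity then makes `ε` small and `n / t ^ d` large.
  rcases le_or_gt (1 / 8 - (2 : ℝ) ^ (-(1 / 8 * ((n : ℝ) / t ^ d - 1))) - 16 * (d : ℝ) * ε) 0
    with h0 | h0
  · refine h0.trans ?_
    rw [← expect_const I 0]
    exact expect_mono I fun x => traceNorm_nonneg _
  have hn' : (1 : ℝ) ≤ n := by exact_mod_cast hn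
  have hd' : (1 : ℝ) ≤ d := by exact_mod_cast hd
  have hpos : (0 : ℝ) < (2 : ℝ) ^ (-(1 / 8 * ((n : ℝ) / t ^ d - 1))) := by positivity
  have hε' : ε < 1 / 128 := by nlinarith
  have hnε : 0 < (n : ℝ) / ε := by positivity
  have h2t : (2 : ℝ) ^ t = n / ε := by
    rw [ht, Real.rpow_logb (by norm_num) (by norm_num) hnε]
  have ht7 : 7 ≤ t := by
    rw [ht, Real.le_logb_iff_rpow_le (by norm_num) hnε, le_div_iff₀ hε]
    norm_num
    linarith
  -- The power of 2 must be below 1/8 = 2^(-3), so with `c = 1/8` the ratio minus 1 exceeds 24.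
  have hratio : 25 < (n : ℝ) / t ^ d := by
    have h8 : (2 : ℝ) ^ (-(1 / 8 * ((n : ℝ) / t ^ d - 1))) < (2 : ℝ) ^ (-3 : ℝ) := by
      rw [show (2 : ℝ) ^ (-3 : ℝ) = 1 / 8 by
        rw [Real.rpow_neg (by norm_num)]; norm_num]
      have : 0 < (d : ℝ) * ε := by positivity
      linarith
    have := (Real.rpow_lt_rpow_left_iff (by norm_num)).1 h8
    linarith
  -- With `τ = ⌈2t⌉`, 2^τ ≥ (n/ε)² bounds the error √(n/2^τ) by `ε`, while τ ≤ 3t gives 2^(d+2)τ ≤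
  -- 24 t^d < n.
  have hτpos : 0 < ⌈2 * t⌉₊ := Nat.ceil_pos.2 (by linarith)
  have hτle : (⌈2 * t⌉₊ : ℝ) < 2 * t + 1 := Nat.ceil_lt_add_one (by linarith)
  have hτge : 2 * t ≤ ⌈2 * t⌉₊ := Nat.le_ceil _
  set τ := ⌈2 * t⌉₊
  have hcard : 2 ^ (d + 2) * τ < I.card := by
    rw [hI]
    rw [lt_div_iff₀ (by positivity)] at hratio
    obtain ⟨e, rfl⟩ : ∃ e, d = e + 1 := ⟨d - 1, by omega⟩
    have h2 : (2 : ℝ) ^ e ≤ t ^ e := pow_le_pow_left₀ (by norm_num) (by linarith) e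
    have h3 : (2 : ℝ) ^ (e + 1 + 2) * τ < n := by
      calc (2 : ℝ) ^ (e + 1 + 2) * τ = 8 * 2 ^ e * τ := by ring
        _ ≤ 8 * t ^ e * (3 * t) := by
          gcongr
          linarith
        _ = 24 * t ^ (e + 1) := by ring
        _ ≤ 25 * t ^ (e + 1) := by
          gcongr
          norm_num
        _ < n := hratio
    exact_mod_cast h3
  obtain ⟨i, hi, j, hj, hij⟩ := C.exists_disjoint_back I τ hτpos hcard
  have hmain := expect_mono I fun x => three_fifths_le_traceNorm_add C (C.prune I τ) I hi hj hij
    x (σ x) (hσ x)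
  rw [expect_const, expect_add, expect_const_mul] at hmain
  have herr := C.expect_norm_output_sub_prune_le I τ hτpos
  have hsqrt : √((I.card : ℝ) / 2 ^ τ) ≤ ε := by
    rw [hI, Real.sqrt_le_left hε.le, div_le_iff₀ (by positivity)]
    have h2 : (n / ε : ℝ) ^ 2 ≤ 2 ^ τ := by
      rw [← h2t, ← Real.rpow_natCast, ← Real.rpow_mul (by norm_num), ← Real.rpow_natCast]
      refine Real.rpow_le_rpow_of_exponent_le (by norm_num) ?_
      push_cast
      linarith
    calc (n : ℝ) ≤ n ^ 2 := by nlinarith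
      _ = ε ^ 2 * (n / ε) ^ 2 := by field_simp
      _ ≤ ε ^ 2 * 2 ^ τ := by gcongr
  have herr' : (d : ℝ) * (2 * √((I.card : ℝ) / 2 ^ τ)) ≤ d * (2 * ε) := by gcongr
  have : 0 < (d : ℝ) * ε := by positivity
  linarith

end QACLine

theorem mainTheorem9 :
    ∃ c : ℝ, 0 < c ∧
      ∀ (n d : ℕ) (ε t : ℝ), 1 ≤ n → 1 ≤ d → 0 < ε → ε < 1 → t = Real.logb 2 ((n : ℝ) / ε) →
        ∀ (m : ℕ) (I : Finset (Fin m)), I.card = n → ∀ C : QACLine.Circuit m d,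
          (∀ ψ₀ ψ₁ : QACLine.Bits I → QACLine.Ket (QACLine.Anc I),
            (∀ x, QACLine.IsUnitKet (ψ₀ x)) → (∀ x, QACLine.IsUnitKet (ψ₁ x)) →
            1 / 8 - (2 : ℝ) ^ (-(c * ((n : ℝ) / t ^ d - 1))) - 16 * (d : ℝ) * ε ≤
              QACLine.expect I fun x =>
                QACLine.traceNorm
                  (QACLine.traceAnc I (QACLine.proj (C.output I x)) -
                    QACLine.traceAnc I (QACLine.proj (QACLine.nekomataKet I x (ψ₀ x) (ψ₁ x))))) ∧
          1 / 8 - (2 : ℝ) ^ (-(c * ((n : ℝ) / t ^ d - 1))) - 16 * (d : ℝ) * ε ≤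
            QACLine.expect I fun x =>
              QACLine.traceNorm
                (QACLine.traceAnc I (QACLine.proj (C.output I x)) -
                  QACLine.proj (QACLine.catKet I x)) := by
  refine ⟨1 / 8, by norm_num, fun n d ε t hn hd hε _ ht m I hI C => ?_⟩
  have hne : I.Nonempty := Finset.card_pos.1 (by omega)
  exact ⟨fun ψ₀ ψ₁ h₀ h₁ => C.le_expect_traceNorm hn hd hε ht I hI _ fun x =>
      QACLine.hasCatDiagonal_nekomata I hne x _ _ (h₀ x) (h₁ x),
    C.le_expect_traceNorm hn hd hε ht I hI _ fun x => QACLine.hasCatDiagonal_cat I hne x⟩
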